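/- For $X=(x_1,\dots,x_n)$ and $Y=(y_1,\dots,y_n)$ in $\mathbb{C}^n$ let $\varphi_n(X,Y)=\sum_{i=1}^n (x_i-y_i)^2\in\mathbb{C}$. A map $f:\mathbb{C}^n\to\mathbb{C}^n$ is said to preserve distance $d\in\mathbb{C}$ if for all $X,Y\in\mathbb{C}^n$, $\varphi_n(X,Y)=d^2$ implies $\varphi_n(f(X),f(Y))=d^2$. Lemma 1. If $n\ge 2$ and $f:\mathbb{C}^n\to\mathbb{C}^n$ is continuous and preserves unit distance (that is, distance $1$), then $f$ preserves every distance $d\in(0,\infty)$. -/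

import Mathlib

/-- The complex bilinear (not Hermitian) "squared distance" on `ℂⁿ`:
`φₙ(X, Y) = ∑ᵢ (xᵢ - yᵢ)²`. -/
def phi {n : ℕ} (X Y : Fin n → ℂ) : ℂ :=
  ∑ i, (X i - Y i) ^ 2

/-- A map `f : ℂⁿ → ℂⁿ` preserves the distance `d ∈ ℂ` if `φₙ(X, Y) = d²` implies
`φₙ(f(X), f(Y)) = d²` for all `X, Y`. -/
def PreservesDistance {n : ℕ} (f : (Fin n → ℂ) → (Fin n → ℂ)) (d : ℂ) : Prop :=
  ∀ X Y : Fin n → ℂ, phi X Y = d ^ 2 → phi (f X) (f Y) = d ^ 2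

/-! Write n = m + 2. A distance is forced if every continuous unit-preserving map preserves it. Two
regular simplices of edge a glued along a facet have apexes at distance aD, where D² = 2(n + 1)/n.
The images of the apexes either coincide or stay at distance aD, by rigidity of simplices
(`eq_or_phi_eq_of_mirror`), and an isosceles triangle with base a excludes coincidence
(`Forced.of_dichotomy`). So aD is forced whenever a is, and since D > 1 it remains to treat d ≤ 1.

For these, take a regular simplex of edge D and codimension two, and the circle of points at
distance D from all its vertices. The distance E across two successive unit chords of the circle is
forced by the same mirror argument. Normalize f by an isometry so that it fixes the axis simplex and
the endpoints of one unit chord. Each further unit step along the circle is then fixed: its only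
alternative is the point two steps back, which E excludes. The step angle is an irrational part of a
full turn (Niven), so by density and continuity the whole circle is fixed, with all its chords.

The form has isotropic vectors, so value 0 does not mean equality; nondegeneracy and nonzero values
replace positivity. -/

open Matrix in
theorem phi_eq_dotProduct {n : ℕ} (X Y : Fin n → ℂ) : phi X Y = (X - Y) ⬝ᵥ (X - Y) := by
  simp [phi, dotProduct, pow_two]

theorem phi_comm {n : ℕ} (X Y : Fin n → ℂ) : phi X Y = phi Y X :=
  Finset.sum_congr rfl fun i _ => by ring

theorem phi_self {n : ℕ} (X : Fin n → ℂ) : phi X X = 0 := by simp [phi]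

/-- Polarization of the form relative to a base point. -/
theorem dotProduct_sub_eq_phi {n : ℕ} (X Z Y : Fin n → ℂ) :
    (X - Y) ⬝ᵥ (Z - Y) = (phi X Y + phi Z Y - phi X Z) / 2 := by
  simp only [phi, dotProduct, ← Finset.sum_add_distrib, ← Finset.sum_sub_distrib,
    Finset.sum_div, Pi.sub_apply]
  exact Finset.sum_congr rfl fun i _ => by ring

/-! ### Isometries of the form and rigidity of simplices. -/

/-- A continuous map of `ℂⁿ` preserving all values of `phi`. -/
structure IsIsom {n : ℕ} (S : (Fin n → ℂ) → (Fin n → ℂ)) : Prop where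
  continuous : Continuous S
  phi_map : ∀ x z, phi (S x) (S z) = phi x z

theorem IsIsom.comp {n : ℕ} {S T : (Fin n → ℂ) → (Fin n → ℂ)} (hS : IsIsom S) (hT : IsIsom T) :
    IsIsom (S ∘ T) :=
  ⟨hS.continuous.comp hT.continuous, fun _ _ => (hS.phi_map _ _).trans (hT.phi_map _ _)⟩

theorem isIsom_add {n : ℕ} (a : Fin n → ℂ) : IsIsom (fun x => x + a) :=
  ⟨by fun_prop, fun _ _ => by simp [phi]⟩

-- Equal images have equal `phi` to every point; testing against z + eᵢ recovers each coordinate.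
open Matrix in
theorem IsIsom.injective {n : ℕ} {S : (Fin n → ℂ) → (Fin n → ℂ)} (hS : IsIsom S) :
    Function.Injective S := by
  intro x z h
  have hw : ∀ w, phi x w = phi z w := fun w => by rw [← hS.phi_map, h, hS.phi_map]
  have h0 : phi x z = 0 := by rw [hw, phi_self]
  ext i
  have h1 := dotProduct_sub_eq_phi x (z + Pi.single i 1) z
  rw [h0, hw (z + Pi.single i 1), phi_comm z] at h1
  simp only [add_sub_cancel_left, dotProduct_single, mul_one, Pi.sub_apply] at h1
  linear_combination h1

/-- The points `p i` are in general position as seen from `y`. -/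
def Spans {n : ℕ} (p : Fin n → Fin n → ℂ) (y : Fin n → ℂ) : Prop :=
  ∀ v : Fin n → ℂ, (∀ i, (p i - y) ⬝ᵥ v = 0) → v = 0

open Matrix in
/-- Simplices with equal edges are congruent. -/
theorem exists_isIsom_simplex {n : ℕ} {p P : Fin n → Fin n → ℂ} {y Y : Fin n → ℂ}
    (hs : Spans p y) (hp : ∀ i j, phi (P i) (P j) = phi (p i) (p j))
    (hy : ∀ i, phi (P i) Y = phi (p i) y) :
    ∃ S, IsIsom S ∧ (∀ i, S (P i) = p i) ∧ S Y = y := by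
  set M : Matrix (Fin n) (Fin n) ℂ := Matrix.of fun i => p i - y with hM
  set M' : Matrix (Fin n) (Fin n) ℂ := Matrix.of fun i => P i - Y with hM'
  have hG : M' * M'ᵀ = M * Mᵀ := by
    ext i j
    have h1 := dotProduct_sub_eq_phi (P i) (P j) Y
    have h2 := dotProduct_sub_eq_phi (p i) (p j) y
    rw [hp, hy, hy, ← h2] at h1
    exact h1
  have hdet : M.det ≠ 0 := by
    intro h
    obtain ⟨v, hv, h0⟩ := Matrix.exists_mulVec_eq_zero_iff.mpr h
    exact hv (hs v fun i => congrFun h0 i)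
  have hdet' : M'.det ≠ 0 := by
    intro h
    have := congrArg Matrix.det hG
    simp only [Matrix.det_mul, Matrix.det_transpose, h, zero_mul] at this
    exact hdet (mul_self_eq_zero.mp this.symm)
  have u' : IsUnit M'.det := isUnit_iff_ne_zero.mpr hdet'
  have ut' : IsUnit M'ᵀ.det := by rwa [Matrix.det_transpose]
  -- Equal Gram matrices make this change of basis orthogonal; it acts on row vectors.
  set O := M'⁻¹ * M with hO
  have hOO : O * Oᵀ = 1 := by
    rw [hO, Matrix.transpose_mul, Matrix.transpose_nonsing_inv, Matrix.mul_assoc,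
      ← Matrix.mul_assoc M, ← hG, Matrix.mul_assoc M', Matrix.mul_nonsing_inv _ ut',
      Matrix.mul_one, Matrix.nonsing_inv_mul _ u']
  have hMO : M' * O = M := by
    rw [hO, ← Matrix.mul_assoc, Matrix.mul_nonsing_inv _ u', Matrix.one_mul]
  refine ⟨fun x => y + (x - Y) ᵥ* O, ⟨?_, fun x z => ?_⟩, fun i => ?_, ?_⟩
  · exact continuous_const.add ((continuous_id.sub continuous_const).matrix_vecMul continuous_const)
  · rw [phi_eq_dotProduct, phi_eq_dotProduct, add_sub_add_left_eq_sub, ← Matrix.sub_vecMul,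
      sub_sub_sub_cancel_right]
    conv_lhs => rw [← Matrix.dotProduct_mulVec, ← Matrix.vecMul_transpose, Matrix.vecMul_vecMul, hOO,
      Matrix.vecMul_one]
  · have h1 : (P i - Y) ᵥ* O = p i - y := by
      have := congrFun hMO i
      rw [Matrix.mul_apply_eq_vecMul] at this
      exact this
    simp [h1]
  · simp

open Matrix in
/-- A point at the same distances from a facet as an apex `y` is `y` or its mirror image `y'`. -/
theorem eq_or_eq_mirror {n : ℕ} {p : Fin n → Fin n → ℂ} {y y' z : Fin n → ℂ}
    (hs : Spans p y) (hy' : ∀ i, phi (p i) y' = phi (p i) y) (hz : ∀ i, phi (p i) z = phi (p i) y)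
    (hne : phi y' y ≠ 0) : z = y ∨ z = y' := by
  have key : ∀ w, (∀ i, phi (p i) w = phi (p i) y) → ∀ i, (p i - y) ⬝ᵥ (w - y) = phi w y / 2 := by
    intro w hw i
    rw [dotProduct_sub_eq_phi, hw]; ring
  -- By `key`, z - y and y' - y have proportional products with a spanning family, so z - y = l(y' -
  -- y). Comparing squares gives l² = l.
  set l := phi z y / phi y' y with hl
  have hb : z - y = l • (y' - y) := by
    rw [← sub_eq_zero]
    refine hs _ fun i => ?_
    rw [dotProduct_sub, dotProduct_smul, key z hz, key y' hy', smul_eq_mul, hl]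
    field_simp
    ring
  have hq : phi z y = l * l * phi y' y := by
    rw [phi_eq_dotProduct, hb, phi_eq_dotProduct]
    simp only [smul_dotProduct, dotProduct_smul, smul_eq_mul, mul_assoc]
  have hl1 : phi z y = l * phi y' y := by rw [hl]; field_simp
  rw [hl1] at hq
  have h2 := mul_right_cancel₀ hne hq
  by_cases h0 : l = 0
  · left; rw [h0, zero_smul, sub_eq_zero] at hb; exact hb
  · right
    have : l = 1 := mul_left_cancel₀ h0 (by rw [← h2, mul_one])
    rw [this, one_smul] at hb
    exact sub_left_injective hb

/-- In a congruent copy of a simplex with its mirror apex, the two apexes coincide or are at the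
original distance. -/
theorem eq_or_phi_eq_of_mirror {n : ℕ} {p P : Fin n → Fin n → ℂ} {y y' Y Y' : Fin n → ℂ}
    (hs : Spans p y) (hy' : ∀ i, phi (p i) y' = phi (p i) y) (hne : phi y' y ≠ 0)
    (hp : ∀ i j, phi (P i) (P j) = phi (p i) (p j)) (hY : ∀ i, phi (P i) Y = phi (p i) y)
    (hY' : ∀ i, phi (P i) Y' = phi (p i) y) : Y' = Y ∨ phi Y' Y = phi y' y := by
  obtain ⟨S, hS, h1, h2⟩ := exists_isIsom_simplex hs hp hY
  have := eq_or_eq_mirror (z := S Y') hs hy' (fun i => by rw [← h1, hS.phi_map, h1, hY']) hne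
  rcases this with h | h
  · left; exact hS.injective (h.trans h2.symm)
  · right; rw [← hS.phi_map, h2, h]

open Matrix in
theorem isIsom_neg {n : ℕ} : IsIsom (fun x : Fin n → ℂ => -x) :=
  ⟨by fun_prop, fun x z => Finset.sum_congr rfl fun i _ => by simp; ring⟩

open Matrix in
theorem isIsom_reflection {n : ℕ} {m : Fin n → ℂ} (hm : m ⬝ᵥ m ≠ 0) :
    IsIsom (fun x => x - (2 * (x ⬝ᵥ m) / (m ⬝ᵥ m)) • m) := by
  refine ⟨?_, fun x z => ?_⟩
  · have : Continuous fun x : Fin n → ℂ => 2 * (x ⬝ᵥ m) / (m ⬝ᵥ m) :=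
      (continuous_const.mul (continuous_id.dotProduct continuous_const)).div_const _
    exact continuous_id.sub (this.smul continuous_const)
  · rw [phi_eq_dotProduct, phi_eq_dotProduct]
    have : x - (2 * (x ⬝ᵥ m) / (m ⬝ᵥ m)) • m - (z - (2 * (z ⬝ᵥ m) / (m ⬝ᵥ m)) • m)
        = (x - z) - (2 * ((x - z) ⬝ᵥ m) / (m ⬝ᵥ m)) • m := by
      rw [sub_dotProduct]; ext i; simp; ring
    rw [this]
    generalize x - z = w
    simp only [sub_dotProduct, dotProduct_sub, smul_dotProduct, dotProduct_smul, smul_eq_mul,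
      dotProduct_comm m w]
    field_simp
    ring

open Matrix in
/-- Vectors of equal nonzero square are exchanged by an isometry fixing the origin. -/
theorem exists_isIsom_vector {n : ℕ} {u v : Fin n → ℂ} (h : u ⬝ᵥ u = v ⬝ᵥ v) (h0 : u ⬝ᵥ u ≠ 0) :
    ∃ S, IsIsom S ∧ S 0 = 0 ∧ S u = v := by
  have e1 : (u - v) ⬝ᵥ (u - v) = 2 * (u ⬝ᵥ u) - 2 * (u ⬝ᵥ v) := by
    rw [sub_dotProduct, dotProduct_sub, dotProduct_sub, dotProduct_comm v u, ← h]; ring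
  have e2 : (u + v) ⬝ᵥ (u + v) = 2 * (u ⬝ᵥ u) + 2 * (u ⬝ᵥ v) := by
    rw [add_dotProduct, dotProduct_add, dotProduct_add, dotProduct_comm v u, ← h]; ring
  -- The squares of u - v and u + v add up to 4 u·u ≠ 0, so one of the two vectors is non-isotropic
  -- and defines a reflection.
  by_cases hm : (u - v) ⬝ᵥ (u - v) = 0
  · have hm' : (u + v) ⬝ᵥ (u + v) ≠ 0 := by
      intro h'
      apply h0
      linear_combination (e1 + e2 - hm - h') * (-1 / 4)
    refine ⟨_, isIsom_neg.comp (isIsom_reflection hm'), by simp, ?_⟩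
    have : 2 * (u ⬝ᵥ (u + v)) / ((u + v) ⬝ᵥ (u + v)) = 1 := by
      rw [div_eq_one_iff_eq hm', e2, dotProduct_add]; ring
    simp only [Function.comp, this, one_smul]; abel
  · refine ⟨_, isIsom_reflection hm, by simp, ?_⟩
    have : 2 * (u ⬝ᵥ (u - v)) / ((u - v) ⬝ᵥ (u - v)) = 1 := by
      rw [div_eq_one_iff_eq hm, e1, dotProduct_sub]; ring
    simp only [this, one_smul]; abel

theorem exists_isIsom_pair {n : ℕ} {x y X Y : Fin n → ℂ} (h : phi x y = phi X Y)
    (h0 : phi x y ≠ 0) : ∃ S, IsIsom S ∧ S x = X ∧ S y = Y := by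
  rw [phi_eq_dotProduct, phi_eq_dotProduct] at h
  rw [phi_eq_dotProduct] at h0
  obtain ⟨S, hS, h1, h2⟩ := exists_isIsom_vector h h0
  refine ⟨_, (isIsom_add Y).comp (hS.comp (isIsom_add (-y))), ?_, ?_⟩
  · simp [← sub_eq_add_neg, h2]
  · simp [h1]

/-! ### Forced distances. -/

/-- Every continuous unit-distance preserving map preserves the distance `d`. -/
def Forced (n : ℕ) (d : ℂ) : Prop :=
  ∀ f : (Fin n → ℂ) → (Fin n → ℂ), Continuous f → PreservesDistance f 1 → PreservesDistance f d

theorem IsIsom.preserves_comp {n : ℕ} {S f : (Fin n → ℂ) → (Fin n → ℂ)} (hS : IsIsom S) {d : ℂ}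
    (hf : PreservesDistance f d) : PreservesDistance (S ∘ f) d := fun X Y h => by
  rw [Function.comp, Function.comp, hS.phi_map]; exact hf X Y h

theorem IsIsom.comp_preserves {n : ℕ} {S f : (Fin n → ℂ) → (Fin n → ℂ)} (hS : IsIsom S) {d : ℂ}
    (hf : PreservesDistance f d) : PreservesDistance (f ∘ S) d := fun X Y h => by
  exact hf _ _ (by rw [hS.phi_map]; exact h)

/-- It suffices to test one pair of points. -/
theorem Forced.of_pair {n : ℕ} {d : ℂ} (hd : d ≠ 0) {x y : Fin n → ℂ} (hxy : phi x y = d ^ 2)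
    (h : ∀ f : (Fin n → ℂ) → (Fin n → ℂ), Continuous f → PreservesDistance f 1 →
      phi (f x) (f y) = d ^ 2) : Forced n d := by
  intro f hf h1 X Y hXY
  obtain ⟨S, hS, rfl, rfl⟩ := exists_isIsom_pair (hxy.trans hXY.symm)
    (by rw [hxy]; exact pow_ne_zero 2 hd)
  exact h (f ∘ S) (hf.comp hS.continuous) (hS.comp_preserves h1)

/-- If the endpoints at distance `d` are never separated wrongly except by collapsing, and some
other distance is forced, then `d` is forced. -/
theorem Forced.of_dichotomy {m : ℕ} {d b : ℂ} (hd : d ≠ 0) (hb : Forced (m + 2) b) (hb0 : b ≠ 0)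
    (hbd : b ^ 2 ≠ d ^ 2) {x y : Fin (m + 2) → ℂ} (hxy : phi x y = d ^ 2)
    (h : ∀ f : (Fin (m + 2) → ℂ) → (Fin (m + 2) → ℂ), Continuous f → PreservesDistance f 1 →
      f x = f y ∨ phi (f x) (f y) = d ^ 2) : Forced (m + 2) d := by
  intro f hf h1
  have hall : ∀ X Y, phi X Y = d ^ 2 → f X = f Y ∨ phi (f X) (f Y) = d ^ 2 := by
    intro X Y hXY
    obtain ⟨S, hS, rfl, rfl⟩ := exists_isIsom_pair (hxy.trans hXY.symm)
      (by rw [hxy]; exact pow_ne_zero 2 hd)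
    exact h (f ∘ S) (hf.comp hS.continuous) (hS.comp_preserves h1)
  intro X Y hXY
  -- Altitude of an isosceles triangle with legs d and base b. Collapsing one leg would give the
  -- image of the base the square 0 or d², never b².
  obtain ⟨c, hc⟩ := IsAlgClosed.exists_pow_nat_eq (d ^ 2 - b ^ 2 / 4) (n := 2) two_pos
  have e (t : ℂ) : phi (0 : Fin (m + 2) → ℂ) (Fin.cons c (Fin.cons t 0)) = c ^ 2 + t ^ 2 := by
    simp [phi, Fin.sum_univ_succ]
  have e' (s t : ℂ) : phi (Fin.cons c (Fin.cons s 0) : Fin (m + 2) → ℂ) (Fin.cons c (Fin.cons t 0))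
      = (s - t) ^ 2 := by
    simp [phi, Fin.sum_univ_succ]
  obtain ⟨S, hS, rfl, rfl⟩ := exists_isIsom_pair
    (x := (0 : Fin (m + 2) → ℂ)) (y := Fin.cons c (Fin.cons (b / 2) 0)) (X := X) (Y := Y)
    (by rw [e, hXY, hc]; ring) (by rw [e, hc]; ring_nf; exact pow_ne_zero 2 hd)
  refine (hall _ _ hXY).resolve_left fun heq => ?_
  set Z := S (Fin.cons c (Fin.cons (-(b / 2)) 0))
  have hZ : phi (S 0) Z = d ^ 2 := by rw [hS.phi_map, e, hc]; ring
  have hYZ := hb f hf h1 (S (Fin.cons c (Fin.cons (b / 2) 0))) Z (by rw [hS.phi_map, e']; ring)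
  rw [← heq] at hYZ
  rcases hall _ _ hZ with h2 | h2
  · rw [h2, phi_self] at hYZ
    exact pow_ne_zero 2 hb0 hYZ.symm
  · exact hbd (hYZ.symm.trans h2)
theorem PreservesDistance.phi_eq {n : ℕ} {f : (Fin n → ℂ) → (Fin n → ℂ)} {d : ℂ}
    (hf : PreservesDistance f d) {X Y : Fin n → ℂ} (h : phi X Y = d ^ 2) :
    phi (f X) (f Y) = phi X Y := (hf X Y h).trans h.symm

/-! ### Regular simplices with vertices on the coordinate axes. -/

theorem phi_single_single {n : ℕ} (k : ℂ) {i j : Fin n} (h : i ≠ j) :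
    phi (Pi.single i k) (Pi.single j k) = 2 * k ^ 2 := by
  have : ∀ l, ((Pi.single i k : Fin n → ℂ) l - (Pi.single j k : Fin n → ℂ) l) ^ 2
      = (Pi.single i (k ^ 2) : Fin n → ℂ) l + (Pi.single j (k ^ 2) : Fin n → ℂ) l := by
    intro l
    rcases eq_or_ne l i with rfl | hi
    · simp [h]
    · rcases eq_or_ne l j with rfl | hj
      · simp [hi]
      · simp [hi, hj]
  simp only [phi, this, Finset.sum_add_distrib, Finset.sum_pi_single', Finset.mem_univ, if_true]
  ring

theorem phi_single_const {n : ℕ} (k t : ℂ) (i : Fin n) :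
    phi (Pi.single i k) (fun _ => t) = n * t ^ 2 - 2 * k * t + k ^ 2 := by
  have : ∀ l, ((Pi.single i k : Fin n → ℂ) l - t) ^ 2
      = (Pi.single i (k ^ 2 - 2 * k * t) : Fin n → ℂ) l + t ^ 2 := by
    intro l
    rcases eq_or_ne l i with rfl | hi
    · simp; ring
    · simp [hi]
  simp only [phi, this, Finset.sum_add_distrib, Finset.sum_pi_single', Finset.mem_univ, if_true,
    Finset.sum_const, Finset.card_univ, Fintype.card_fin, nsmul_eq_mul]
  ring

-- The condition k ≠ nt keeps the apex off the hyperplane ∑ xᵢ = k of the facet.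
open Matrix in
theorem spans_single_const {n : ℕ} {k t : ℂ} (hk : k ≠ 0) (ht : k ≠ n * t) :
    Spans (fun i : Fin n => Pi.single i k) (fun _ => t) := by
  intro v hv
  have h1 : ∀ i, k * v i = t * ∑ j, v j := by
    intro i
    have := hv i
    rw [sub_dotProduct, single_dotProduct, sub_eq_zero] at this
    rw [this, dotProduct, Finset.mul_sum]
  have h2 : k * ∑ j, v j = n * t * ∑ j, v j := by
    rw [Finset.mul_sum, Finset.sum_congr rfl fun i _ => h1 i]
    simp [mul_assoc]
  have h3 : ∑ j, v j = 0 := by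
    by_contra h
    exact ht (mul_right_cancel₀ h h2)
  ext i
  have := h1 i
  rw [h3, mul_zero] at this
  exact (mul_eq_zero.mp this).resolve_left hk

/-- The distance between the apexes of two regular simplices of edge `a` glued along a facet. -/
theorem Forced.glued_simplices {m : ℕ} {a d : ℂ} (ha : Forced (m + 2) a) (ha0 : a ≠ 0)
    (hd : d ^ 2 = a ^ 2 * (2 * (m + 3) / (m + 2))) : Forced (m + 2) d := by
  obtain ⟨k, hk⟩ := IsAlgClosed.exists_pow_nat_eq (a ^ 2 / 2) (n := 2) two_pos
  -- The two apexes over the facet lie on the diagonal, with all coordinates equal to k(1 ± w)/(m +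
  -- 2).
  obtain ⟨w, hw⟩ := IsAlgClosed.exists_pow_nat_eq ((m : ℂ) + 3) (n := 2) two_pos
  have hN : (m : ℂ) + 2 ≠ 0 := by exact_mod_cast (by omega : m + 2 ≠ 0)
  have hN' : (m : ℂ) + 3 ≠ 0 := by exact_mod_cast (by omega : m + 3 ≠ 0)
  have hN'' : (m : ℂ) + 4 ≠ 0 := by exact_mod_cast (by omega : m + 4 ≠ 0)
  have ha2 : a ^ 2 ≠ 0 := pow_ne_zero 2 ha0
  have hk0 : k ≠ 0 := by
    rintro rfl
    apply ha2
    linear_combination -2 * hk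
  have hw0 : w ≠ 0 := by
    rintro rfl
    apply hN'
    linear_combination -hw
  have hd2 : d ^ 2 ≠ 0 := by
    rw [hd]; exact mul_ne_zero ha2 (div_ne_zero (mul_ne_zero two_ne_zero hN') hN)
  have hd0 : d ≠ 0 := fun h => hd2 (by rw [h]; ring)
  have hap : ∀ s : ℂ, s ^ 2 = m + 3 → ∀ i : Fin (m + 2),
      phi (Pi.single i k) (fun _ => k * (1 + s) / (m + 2)) = a ^ 2 := by
    intro s hs i
    rw [phi_single_const]
    push_cast
    field_simp
    linear_combination k ^ 2 * hs + 2 * (m + 2) * hk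
  have hyy : phi (fun _ : Fin (m + 2) => k * (1 + -w) / (m + 2)) (fun _ => k * (1 + w) / (m + 2))
      = d ^ 2 := by
    rw [hd]
    simp only [phi, Finset.sum_const, Finset.card_univ, Fintype.card_fin, nsmul_eq_mul]
    push_cast
    field_simp
    linear_combination 4 * k ^ 2 * hw + 4 * (m + 3) * hk
  have hw' : (-w) ^ 2 = (m : ℂ) + 3 := by rw [neg_sq, hw]
  refine Forced.of_dichotomy hd0 ha ha0 ?_ hyy fun f hf h1 => ?_
  · rw [hd]
    intro h
    field_simp at h
    exact hN'' (by linear_combination -h)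
  · rw [← hyy]
    have hfa := ha f hf h1
    refine eq_or_phi_eq_of_mirror (p := fun i => Pi.single i k) (P := fun i => f (Pi.single i k))
      (spans_single_const hk0 ?_) (fun i => ?_) (by rw [hyy]; exact hd2) (fun i j => ?_)
      (fun i => ?_) (fun i => ?_)
    · intro h
      push_cast at h
      field_simp at h
      exact hw0 (by linear_combination -h)
    · rw [hap _ hw, hap _ hw']
    · rcases eq_or_ne i j with rfl | hij
      · rw [phi_self, phi_self]
      · exact hfa.phi_eq (by rw [phi_single_single k hij, hk]; ring)
    · exact hfa.phi_eq (hap _ hw i)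
    · exact (hfa _ _ (hap _ hw' i)).trans (hap _ hw i).symm

/-! ### The circle around a codimension-two simplex. -/

/-- Parameters of a circle around a regular simplex of codimension two. -/
structure CircleData (m : ℕ) (r s k : ℂ) : Prop where
  -- r is the radius; (m + 1)s² = r² since s multiplies the all-ones vector of length m + 1; 2k² =
  -- D² is the squared edge.
  hr : r ^ 2 = (m + 3) / (m + 1)
  hs : s ^ 2 = (m + 3) / (m + 1) ^ 2
  hk : k ^ 2 = (m + 3) / (m + 2)

/-- The vertices of a regular simplex of codimension two. -/
noncomputable def axisVertex (m : ℕ) (k : ℂ) (i : Fin (m + 1)) : Fin (m + 2) → ℂ :=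
  Fin.cons 0 (Pi.single i k)

/-- A circle of points equidistant from all `axisVertex m k i`. -/
noncomputable def circlePoint (m : ℕ) (r s k : ℂ) (t : ℝ) : Fin (m + 2) → ℂ :=
  Fin.cons (r * (Real.cos t : ℂ)) fun _ => k / (m + 1) + s * (Real.sin t : ℂ)

theorem phi_cons {n : ℕ} (a b : ℂ) (x y : Fin n → ℂ) :
    phi (Fin.cons a x : Fin (n + 1) → ℂ) (Fin.cons b y) = (a - b) ^ 2 + phi x y := by
  simp [phi, Fin.sum_univ_succ]

section Circle
variable {m : ℕ} {r s k : ℂ}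

theorem phi_axisVertex (h : CircleData m r s k) {i j : Fin (m + 1)} (hij : i ≠ j) :
    phi (axisVertex m k i) (axisVertex m k j) = 2 * (m + 3) / (m + 2) := by
  rw [axisVertex, axisVertex, phi_cons, phi_single_single k hij, h.hk]
  ring

theorem phi_axisVertex_circlePoint (h : CircleData m r s k) (i : Fin (m + 1)) (t : ℝ) :
    phi (axisVertex m k i) (circlePoint m r s k t) = 2 * (m + 3) / (m + 2) := by
  have h1 : (m : ℂ) + 1 ≠ 0 := by exact_mod_cast (by omega : m + 1 ≠ 0)
  have h2 : (m : ℂ) + 2 ≠ 0 := by exact_mod_cast (by omega : m + 2 ≠ 0)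
  have hcs : (Real.sin t : ℂ) ^ 2 + (Real.cos t : ℂ) ^ 2 = 1 := by
    exact_mod_cast Real.sin_sq_add_cos_sq t
  rw [axisVertex, circlePoint, phi_cons, phi_single_const]
  generalize (Real.sin t : ℂ) = S at *
  generalize (Real.cos t : ℂ) = C at *
  have : (0 - r * C) ^ 2 + (((m + 1 : ℕ) : ℂ) * (k / (m + 1) + s * S) ^ 2
      - 2 * k * (k / (m + 1) + s * S) + k ^ 2)
      = r ^ 2 * C ^ 2 + (m + 1) * s ^ 2 * S ^ 2 + k ^ 2 * (m / (m + 1)) := by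
    push_cast
    field_simp
    ring
  rw [this, h.hr, h.hs, h.hk]
  field_simp
  linear_combination (m + 2) * (m + 3) * hcs

theorem phi_circlePoint (h : CircleData m r s k) (t u : ℝ) :
    phi (circlePoint m r s k t) (circlePoint m r s k u)
      = (m + 3) / (m + 1) * (2 - 2 * (Real.cos (t - u) : ℂ)) := by
  have h1 : (m : ℂ) + 1 ≠ 0 := by exact_mod_cast (by omega : m + 1 ≠ 0)
  have hcs (t : ℝ) : (Real.sin t : ℂ) ^ 2 + (Real.cos t : ℂ) ^ 2 = 1 := by
    exact_mod_cast Real.sin_sq_add_cos_sq t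
  have ht := hcs t
  have hu := hcs u
  rw [circlePoint, circlePoint, phi_cons, Real.cos_sub, Complex.ofReal_add, Complex.ofReal_mul,
    Complex.ofReal_mul]
  generalize (Real.sin t : ℂ) = S at *
  generalize (Real.cos t : ℂ) = C at *
  generalize (Real.sin u : ℂ) = S' at *
  generalize (Real.cos u : ℂ) = C' at *
  have : (r * C - r * C') ^ 2 + phi (fun _ : Fin (m + 1) => k / (m + 1) + s * S)
      (fun _ => k / (m + 1) + s * S') = r ^ 2 * (C - C') ^ 2 + (m + 1) * s ^ 2 * (S - S') ^ 2 := by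
    simp only [phi, Finset.sum_const, Finset.card_univ, Fintype.card_fin, nsmul_eq_mul]
    push_cast
    ring
  rw [this, h.hr, h.hs]
  field_simp
  linear_combination (m + 3) * (ht + hu)

/-- The facet of a simplex formed by the axis and one circle point. -/
noncomputable def circleFacet (m : ℕ) (r s k : ℂ) (t : ℝ) : Fin (m + 2) → Fin (m + 2) → ℂ :=
  Fin.cons (circlePoint m r s k t) (axisVertex m k)

-- Seen from the centre, the two circle points have determinant r s sin(t - u) up to sign, so they
-- are independent of each other.
open Matrix in
theorem spans_circleFacet (h : CircleData m r s k) {t u : ℝ} (hsin : Real.sin (t - u) ≠ 0) :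
    Spans (circleFacet m r s k t) (circlePoint m r s k u) := by
  have h1 : (m : ℂ) + 1 ≠ 0 := by exact_mod_cast (by omega : m + 1 ≠ 0)
  have h2 : (m : ℂ) + 2 ≠ 0 := by exact_mod_cast (by omega : m + 2 ≠ 0)
  have h3 : (m : ℂ) + 3 ≠ 0 := by exact_mod_cast (by omega : m + 3 ≠ 0)
  have hr0 : r ≠ 0 := fun h' => div_ne_zero h3 h1 (by rw [← h.hr, h']; ring)
  have hs0 : s ≠ 0 := fun h' => div_ne_zero h3 (pow_ne_zero 2 h1) (by rw [← h.hs, h']; ring)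
  have hk0 : k ≠ 0 := fun h' => div_ne_zero h3 h2 (by rw [← h.hk, h']; ring)
  have hS : (Real.sin t : ℂ) * Real.cos u - Real.cos t * Real.sin u ≠ 0 := by
    rw [Real.sin_sub] at hsin
    exact_mod_cast hsin
  intro v hv
  have ht := hv 0
  have hax : ∀ i : Fin (m + 1), k * v i.succ = r * Real.cos u * v 0
      + (k / (m + 1) + s * Real.sin u) * ∑ j : Fin (m + 1), v j.succ := by
    intro i
    have := hv i.succ
    rw [sub_dotProduct, sub_eq_zero] at this
    simpa [circleFacet, axisVertex, circlePoint, dotProduct, Fin.sum_univ_succ (n := m + 1),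
      Finset.mul_sum, Pi.single_apply] using this
  have ht' : r * Real.cos t * v 0 + s * Real.sin t * ∑ j : Fin (m + 1), v j.succ
      = r * Real.cos u * v 0 + s * Real.sin u * ∑ j : Fin (m + 1), v j.succ := by
    rw [sub_dotProduct, sub_eq_zero] at ht
    simp only [circleFacet, circlePoint, dotProduct, Fin.sum_univ_succ (n := m + 1), Fin.cons_zero,
      Fin.cons_succ, ← Finset.mul_sum] at ht
    linear_combination ht
  set W := ∑ j : Fin (m + 1), v j.succ with hW
  have hsum : k * W = (m + 1) * (r * Real.cos u * v 0 + (k / (m + 1) + s * Real.sin u) * W) := by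
    conv_lhs => rw [hW, Finset.mul_sum, Finset.sum_congr rfl fun i _ => hax i]
    simp [mul_add]
  have hu' : r * Real.cos u * v 0 + s * Real.sin u * W = 0 := by
    have : (m + 1) * (r * Real.cos u * v 0 + s * Real.sin u * W) = 0 := by
      field_simp at hsum
      linear_combination -hsum
    exact (mul_eq_zero.mp this).resolve_left h1
  rw [hu'] at ht'
  have hv0 : v 0 = 0 := by
    have : r * ((Real.sin t : ℂ) * Real.cos u - Real.cos t * Real.sin u) * v 0 = 0 := by
      linear_combination Real.sin t * hu' - Real.sin u * ht'
    exact (mul_eq_zero.mp this).resolve_left (mul_ne_zero hr0 hS)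
  have hW0 : W = 0 := by
    have : s * ((Real.sin t : ℂ) * Real.cos u - Real.cos t * Real.sin u) * W = 0 := by
      linear_combination Real.cos u * ht' - Real.cos t * hu'
    exact (mul_eq_zero.mp this).resolve_left (mul_ne_zero hs0 hS)
  ext i
  refine Fin.cases hv0 (fun i => ?_) i
  have := hax i
  rw [hv0, hW0, mul_zero, mul_zero, add_zero] at this
  exact (mul_eq_zero.mp this).resolve_left hk0

theorem continuous_circlePoint : Continuous (circlePoint m r s k) := by
  refine continuous_pi fun i => ?_
  refine Fin.cases ?_ (fun i => ?_) i
  · simp only [circlePoint, Fin.cons_zero]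
    fun_prop
  · simp only [circlePoint, Fin.cons_succ]
    fun_prop

/-- This cosine is that of the angle subtended by a unit chord. -/
theorem phi_circlePoint_of_cos (h : CircleData m r s k) {t u : ℝ}
    (hc : Real.cos (t - u) = (m + 5) / (2 * (m + 3))) :
    phi (circlePoint m r s k t) (circlePoint m r s k u) = 1 ^ 2 := by
  have h1 : (m : ℂ) + 1 ≠ 0 := by exact_mod_cast (by omega : m + 1 ≠ 0)
  have h3 : (m : ℂ) + 3 ≠ 0 := by exact_mod_cast (by omega : m + 3 ≠ 0)
  rw [phi_circlePoint h, hc]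
  push_cast
  field_simp
  ring

theorem sin_ne_zero_of_cos {x : ℝ} (hc : Real.cos x = (m + 5) / (2 * (m + 3))) :
    Real.sin x ≠ 0 := by
  intro h
  have h2 := Real.sin_sq_add_cos_sq x
  rw [h, hc] at h2
  have : (0 : ℝ) ≤ m := m.cast_nonneg
  field_simp at h2
  nlinarith

theorem phi_circlePoint_two_steps (h : CircleData m r s k) {t e : ℝ}
    (hc : Real.cos e = (m + 5) / (2 * (m + 3))) :
    phi (circlePoint m r s k (t + e + e)) (circlePoint m r s k t) = (3 * m + 11) / (m + 3) := by
  have h1 : (m : ℂ) + 1 ≠ 0 := by exact_mod_cast (by omega : m + 1 ≠ 0)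
  have h3 : (m : ℂ) + 3 ≠ 0 := by exact_mod_cast (by omega : m + 3 ≠ 0)
  rw [phi_circlePoint h, show t + e + e - t = 2 * e by ring, Real.cos_two_mul, hc]
  push_cast
  field_simp
  ring

/-- Maps preserving the relevant distances preserve the shape of the simplices at the circle. -/
theorem phi_map_circleFacet (h : CircleData m r s k) {f : (Fin (m + 2) → ℂ) → (Fin (m + 2) → ℂ)}
    {D : ℂ} (hD : D ^ 2 = 2 * (m + 3) / (m + 2)) (hfD : PreservesDistance f D) (t : ℝ)
    (i j : Fin (m + 2)) :
    phi (f (circleFacet m r s k t i)) (f (circleFacet m r s k t j))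
      = phi (circleFacet m r s k t i) (circleFacet m r s k t j) := by
  rcases eq_or_ne i j with rfl | hij
  · rw [phi_self, phi_self]
  apply hfD.phi_eq
  rw [hD]
  revert hij
  refine Fin.cases ?_ (fun i => ?_) i <;> refine Fin.cases ?_ (fun j => ?_) j
  · simp
  · intro _
    rw [phi_comm]
    exact phi_axisVertex_circlePoint h j t
  · intro _
    exact phi_axisVertex_circlePoint h i t
  · intro hij
    exact phi_axisVertex h (fun h => hij (congrArg Fin.succ h))

theorem phi_circleFacet_circlePoint (h : CircleData m r s k) {t u : ℝ}
    (hc : Real.cos (t - u) = (m + 5) / (2 * (m + 3))) (i : Fin (m + 2)) :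
    phi (circleFacet m r s k t i) (circlePoint m r s k u)
      = Fin.cases 1 (fun _ => 2 * (m + 3) / (m + 2)) i := by
  refine Fin.cases ?_ (fun i => ?_) i
  · exact (phi_circlePoint_of_cos h hc).trans (one_pow 2)
  · exact phi_axisVertex_circlePoint h i u

theorem phi_map_circleFacet_circlePoint (h : CircleData m r s k)
    {f : (Fin (m + 2) → ℂ) → (Fin (m + 2) → ℂ)}
    {D : ℂ} (hD : D ^ 2 = 2 * (m + 3) / (m + 2)) (hfD : PreservesDistance f D)
    (h1 : PreservesDistance f 1) {t u : ℝ}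
    (hc : Real.cos (t - u) = (m + 5) / (2 * (m + 3))) (i : Fin (m + 2)) :
    phi (f (circleFacet m r s k t i)) (f (circlePoint m r s k u))
      = phi (circleFacet m r s k t i) (circlePoint m r s k u) := by
  refine Fin.cases ?_ (fun i => ?_) i
  · exact h1.phi_eq (phi_circlePoint_of_cos h hc)
  · exact hfD.phi_eq ((phi_axisVertex_circlePoint h i u).trans hD.symm)

/-- The points one step before and after a circle point are mirror apexes over the facet it spans
with the axis, so the dichotomy applies with base 1. -/
theorem forced_two_steps {c : ℝ} (h : CircleData m r s k)
    (hc : Real.cos c = (m + 5) / (2 * (m + 3))) {D E : ℂ} (hD : D ^ 2 = 2 * (m + 3) / (m + 2))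
    (hFD : Forced (m + 2) D) (hE : E ^ 2 = (3 * m + 11) / (m + 3)) : Forced (m + 2) E := by
  have h3 : (m : ℂ) + 3 ≠ 0 := by exact_mod_cast (by omega : m + 3 ≠ 0)
  have h11 : 3 * (m : ℂ) + 11 ≠ 0 := by exact_mod_cast (by omega : 3 * m + 11 ≠ 0)
  have hE2 : E ^ 2 ≠ 0 := by rw [hE]; exact div_ne_zero h11 h3
  have hpair := (phi_circlePoint_two_steps (t := 0) h hc).trans hE.symm
  have hc1 : Real.cos (0 + c - 0) = (m + 5) / (2 * (m + 3)) := by simpa using hc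
  have hc2 : Real.cos (0 + c - (0 + c + c)) = (m + 5) / (2 * (m + 3)) := by simpa using hc
  refine Forced.of_dichotomy (fun h0 => hE2 (by rw [h0]; ring)) (fun _ _ h => h) one_ne_zero ?_
    hpair fun f hf h1 => ?_
  · rw [hE]
    intro h'
    field_simp at h'
    have : (2 * m + 8 : ℂ) ≠ 0 := by exact_mod_cast (by omega : 2 * m + 8 ≠ 0)
    exact this (by linear_combination -h')
  · rw [← hpair]
    have hfD := hFD f hf h1
    refine eq_or_phi_eq_of_mirror (spans_circleFacet h (sin_ne_zero_of_cos hc1)) (fun i => ?_)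
      (by rwa [hpair]) (P := fun i => f (circleFacet m r s k (0 + c) i))
      (phi_map_circleFacet h hD hfD _) (phi_map_circleFacet_circlePoint h hD hfD h1 hc1)
      (fun i => ?_)
    · rw [phi_circleFacet_circlePoint h hc1, phi_circleFacet_circlePoint h hc2]
    · rw [phi_map_circleFacet_circlePoint h hD hfD h1 hc2, phi_circleFacet_circlePoint h hc1,
        phi_circleFacet_circlePoint h hc2]

theorem fixes_next {g : (Fin (m + 2) → ℂ) → (Fin (m + 2) → ℂ)} (h : CircleData m r s k)
    {D E : ℂ} (hD : D ^ 2 = 2 * (m + 3) / (m + 2)) (hE : E ^ 2 = (3 * m + 11) / (m + 3))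
    (h1 : PreservesDistance g 1) (hgD : PreservesDistance g D) (hgE : PreservesDistance g E)
    (hax : ∀ i, g (axisVertex m k i) = axisVertex m k i) {e : ℝ}
    (hc : Real.cos e = (m + 5) / (2 * (m + 3))) {t : ℝ}
    (ht : g (circlePoint m r s k t) = circlePoint m r s k t)
    (hte : g (circlePoint m r s k (t + e)) = circlePoint m r s k (t + e)) :
    g (circlePoint m r s k (t + e + e)) = circlePoint m r s k (t + e + e) := by
  have h3 : (m : ℂ) + 3 ≠ 0 := by exact_mod_cast (by omega : m + 3 ≠ 0)
  have h11 : 3 * (m : ℂ) + 11 ≠ 0 := by exact_mod_cast (by omega : 3 * m + 11 ≠ 0)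
  have hne := phi_circlePoint_two_steps (t := t) h hc
  have hne0 : (3 * m + 11 : ℂ) / (m + 3) ≠ 0 := div_ne_zero h11 h3
  have hc1 : Real.cos (t + e - t) = (m + 5) / (2 * (m + 3)) := by simpa using hc
  have hc2 : Real.cos (t + e - (t + e + e)) = (m + 5) / (2 * (m + 3)) := by simpa using hc
  have hfix : ∀ i, g (circleFacet m r s k (t + e) i) = circleFacet m r s k (t + e) i :=
    Fin.cases hte hax
  refine (eq_or_eq_mirror (spans_circleFacet h (sin_ne_zero_of_cos hc1)) (fun i => ?_)
    (fun i => ?_) (by rwa [hne])).resolve_left fun heq => ?_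
  · rw [phi_circleFacet_circlePoint h hc1, phi_circleFacet_circlePoint h hc2]
  · rw [← hfix, phi_map_circleFacet_circlePoint h hD hgD h1 hc2,
      phi_circleFacet_circlePoint h hc2, hfix, phi_circleFacet_circlePoint h hc1]
  · have := hgE.phi_eq (hne.trans hE.symm)
    rw [heq, ht, phi_self, hne] at this
    exact hne0 this.symm

/-- The cosine is rational and strictly between 1/2 and 1, which Niven's theorem forbids for
rational multiples of π. -/
theorem irrational_of_cos {c : ℝ} (hc : Real.cos c = (m + 5) / (2 * (m + 3))) :
    Irrational (c / (2 * Real.pi)) := by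
  rintro ⟨q, hq⟩
  have hc' : c = ((2 * q : ℚ) : ℝ) * Real.pi := by
    push_cast
    rw [hq]
    field_simp
  have := niven ⟨_, hc'⟩ ⟨(m + 5) / (2 * (m + 3)), by rw [hc]; push_cast; rfl⟩
  rw [hc] at this
  have hm : (0 : ℝ) ≤ m := m.cast_nonneg
  have hlo : (1 / 2 : ℝ) < (m + 5) / (2 * (m + 3)) := by
    rw [div_lt_div_iff₀ (by norm_num) (by positivity)]; linarith
  have hhi : ((m : ℝ) + 5) / (2 * (m + 3)) < 1 := by
    rw [div_lt_one (by positivity)]; linarith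
  simp only [Set.mem_insert_iff, Set.mem_singleton_iff] at this
  rcases this with h | h | h | h | h <;> linarith

theorem circlePoint_add_int_mul (t : ℝ) (n : ℤ) :
    circlePoint m r s k (t + n * (2 * Real.pi)) = circlePoint m r s k t := by
  rw [circlePoint, circlePoint, Real.cos_add_int_mul_two_pi, Real.sin_add_int_mul_two_pi]

theorem fixes_circle {g : (Fin (m + 2) → ℂ) → (Fin (m + 2) → ℂ)} (h : CircleData m r s k)
    {D E : ℂ} (hD : D ^ 2 = 2 * (m + 3) / (m + 2)) (hE : E ^ 2 = (3 * m + 11) / (m + 3))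
    (hg : Continuous g)
    (h1 : PreservesDistance g 1) (hgD : PreservesDistance g D) (hgE : PreservesDistance g E)
    (hax : ∀ i, g (axisVertex m k i) = axisVertex m k i) {c : ℝ}
    (hc : Real.cos c = (m + 5) / (2 * (m + 3)))
    (h0 : g (circlePoint m r s k 0) = circlePoint m r s k 0)
    (hgc : g (circlePoint m r s k c) = circlePoint m r s k c) (t : ℝ) :
    g (circlePoint m r s k t) = circlePoint m r s k t := by
  have hnat : ∀ e : ℝ, Real.cos e = (m + 5) / (2 * (m + 3)) → ∀ t,
      g (circlePoint m r s k t) = circlePoint m r s k t →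
      g (circlePoint m r s k (t + e)) = circlePoint m r s k (t + e) → ∀ l : ℕ,
      g (circlePoint m r s k (t + l * e)) = circlePoint m r s k (t + l * e) ∧
      g (circlePoint m r s k (t + l * e + e)) = circlePoint m r s k (t + l * e + e) := by
    intro e he t ht hte l
    induction l with
    | zero => simpa using ⟨ht, hte⟩
    | succ l ih =>
      have := fixes_next h hD hE h1 hgD hgE hax he ih.1 ih.2
      rw [show t + ((l + 1 : ℕ) : ℝ) * e = t + l * e + e by push_cast; ring]
      exact ⟨ih.2, this⟩
  have hint : ∀ l : ℤ, g (circlePoint m r s k (l * c)) = circlePoint m r s k (l * c) := by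
    intro l
    obtain ⟨n, rfl | rfl⟩ := l.eq_nat_or_neg
    · have := (hnat c hc 0 h0 (by simpa using hgc) n).1
      simpa using this
    -- Stepping backwards starts from the fixed pair c, 0; the second point of the n-th pair is at
    -- angle -nc.
    · have := (hnat (-c) (by rw [Real.cos_neg, hc]) c hgc (by simpa using h0) n).2
      rw [show c + (n : ℝ) * -c + -c = ((-(n : ℤ) : ℤ) : ℝ) * c by push_cast; ring] at this
      exact this
  have hd := dense_addSubgroupClosure_pair_iff.mpr (irrational_of_cos hc)
  have hcl : IsClosed {t | g (circlePoint m r s k t) = circlePoint m r s k t} :=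
    isClosed_eq (hg.comp continuous_circlePoint) continuous_circlePoint
  have hsub : (AddSubgroup.closure {c, 2 * Real.pi} : Set ℝ) ⊆
      {t | g (circlePoint m r s k t) = circlePoint m r s k t} := by
    intro x hx
    obtain ⟨a, b, rfl⟩ := AddSubgroup.mem_closure_pair.mp hx
    simp only [zsmul_eq_mul, Set.mem_ofPred_eq, circlePoint_add_int_mul]
    exact hint a
  exact hcl.closure_subset_iff.mpr hsub (hd t)

end Circle

/-! ### Small distances, then all distances by scaling. -/

/-- Since r² > 1, every such d is a chord of the circle, and f agrees on the circle with an isometry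
up to composition. -/
theorem forced_of_le_one {m : ℕ} {D : ℂ} (hD : D ^ 2 = 2 * (m + 3) / (m + 2))
    (hFD : Forced (m + 2) D) {d : ℝ} (hd : 0 < d) (hd1 : d ≤ 1) : Forced (m + 2) d := by
  obtain ⟨r, hr⟩ := IsAlgClosed.exists_pow_nat_eq ((m + 3 : ℂ) / (m + 1)) (n := 2) two_pos
  obtain ⟨s, hs⟩ := IsAlgClosed.exists_pow_nat_eq ((m + 3 : ℂ) / (m + 1) ^ 2) (n := 2) two_pos
  obtain ⟨k, hk⟩ := IsAlgClosed.exists_pow_nat_eq ((m + 3 : ℂ) / (m + 2)) (n := 2) two_pos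
  obtain ⟨E, hE⟩ := IsAlgClosed.exists_pow_nat_eq ((3 * m + 11 : ℂ) / (m + 3)) (n := 2) two_pos
  have h : CircleData m r s k := ⟨hr, hs, hk⟩
  have hm : (0 : ℝ) ≤ m := m.cast_nonneg
  obtain ⟨c, hc⟩ : ∃ c : ℝ, Real.cos c = (m + 5) / (2 * (m + 3)) := by
    refine ⟨_, Real.cos_arccos (le_trans (by norm_num) (by positivity : (0 : ℝ) ≤ _)) ?_⟩
    rw [div_le_one (by positivity)]; linarith
  obtain ⟨u, hu⟩ : ∃ u : ℝ, Real.cos u = 1 - d ^ 2 * ((m + 1) / (2 * (m + 3))) := by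
    have hq : ((m : ℝ) + 1) / (2 * (m + 3)) ≤ 1 := by
      rw [div_le_one (by positivity)]; linarith
    have hq0 : (0 : ℝ) ≤ (m + 1) / (2 * (m + 3)) := by positivity
    refine ⟨_, Real.cos_arccos ?_ ?_⟩ <;> nlinarith [mul_le_mul hd1 hd1 hd.le zero_le_one]
  have hFE := forced_two_steps h hc hD hFD hE
  have hpair : phi (circlePoint m r s k u) (circlePoint m r s k 0) = (d : ℂ) ^ 2 := by
    have h1 : (m : ℂ) + 1 ≠ 0 := by exact_mod_cast (by omega : m + 1 ≠ 0)
    have h3 : (m : ℂ) + 3 ≠ 0 := by exact_mod_cast (by omega : m + 3 ≠ 0)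
    rw [phi_circlePoint h, sub_zero, hu]
    push_cast
    field_simp
    ring
  refine Forced.of_pair (Complex.ofReal_ne_zero.mpr hd.ne') hpair fun f hf h1 => ?_
  have hfD := hFD f hf h1
  have hc1 : Real.cos (c - 0) = (m + 5) / (2 * (m + 3)) := by simpa using hc
  obtain ⟨S, hS, hSp, hS0⟩ := exists_isIsom_simplex
    (spans_circleFacet h (sin_ne_zero_of_cos hc1)) (P := fun i => f (circleFacet m r s k c i))
    (phi_map_circleFacet h hD hfD _) (phi_map_circleFacet_circlePoint h hD hfD h1 hc1)
  have hfix := fixes_circle (g := S ∘ f) h hD hE (hS.continuous.comp hf) (hS.preserves_comp h1)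
    (hS.preserves_comp hfD) (hS.preserves_comp (hFE f hf h1)) (fun i => hSp i.succ) hc hS0 (hSp 0)
  rw [← hS.phi_map]
  exact (congrArg₂ phi (hfix u) (hfix 0)).trans hpair

theorem forced_of_pos (m : ℕ) {d : ℝ} (hd : 0 < d) : Forced (m + 2) d := by
  have hm : (0 : ℝ) ≤ m := m.cast_nonneg
  set D : ℝ := Real.sqrt (2 * (m + 3) / (m + 2)) with hDdef
  have hD2 : D ^ 2 = 2 * (m + 3) / (m + 2) := Real.sq_sqrt (by positivity)
  have hD1 : 1 < D := by
    rw [hDdef, Real.lt_sqrt zero_le_one, lt_div_iff₀ (by positivity)]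
    linarith
  have hDC : (D : ℂ) ^ 2 = 2 * (m + 3) / (m + 2) := by
    rw [← Complex.ofReal_pow, hD2]; push_cast; rfl
  have hFD : Forced (m + 2) D :=
    Forced.glued_simplices (a := 1) (fun _ _ h => h) one_ne_zero (by rw [hDC]; ring)
  -- Dividing by D at most l times brings d down to at most 1; gluing simplices climbs back.
  obtain ⟨l, hl⟩ := pow_unbounded_of_one_lt d hD1
  induction l generalizing d with
  | zero => exact forced_of_le_one hDC hFD hd (by simpa using hl.le)
  | succ l ih =>
    have hD0 : 0 < D := by linarith
    have := ih (d := d / D) (by positivity) (by rw [div_lt_iff₀ hD0, ← pow_succ]; exact hl)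
    refine this.glued_simplices (Complex.ofReal_ne_zero.mpr (by positivity)) ?_
    rw [← hDC]
    have : (D : ℂ) ≠ 0 := Complex.ofReal_ne_zero.mpr hD0.ne'
    push_cast
    field_simp

theorem lemma1 (n : ℕ) (hn : 2 ≤ n) (f : (Fin n → ℂ) → (Fin n → ℂ))
    (hf : Continuous f) (hunit : PreservesDistance f 1) (d : ℝ) (hd : 0 < d) :
    PreservesDistance f (d : ℂ) := by
  obtain ⟨m, rfl⟩ := Nat.exists_eq_add_of_le' hn
  exact forced_of_pos m hd f hf hunit
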